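/- Let $d\ge 2$ and let $\Omega\subset\mathbb{R}^d$ be a bounded, connected, nonempty open set. Let $H^1(\Omega)$ be the space of real-valued functions $u\in L^2(\Omega)$ with weak partial derivatives $\partial_j u\in L^2(\Omega)$, with norm $\|u\|_{H^1(\Omega)}=\big(\|u\|_{L^2(\Omega)}^2+\sum_{j=1}^d\|\partial_j u\|_{L^2(\Omega)}^2\big)^{1/2}$, and let $H^1_0(\Omega)$ be the closure of $C_c^\infty(\Omega)$ in $H^1(\Omega)$. Let $C_0(\Omega)$ be the space of continuous $v\colon\Omega\to\mathbb{R}$ such that $\lim_{x\to z}v(x)=0$ for every $z\in\partial\Omega$. For $v$ continuous and bounded on $\Omega$, write $\Delta v\in H^{-1}(\Omega)$ if there is $M\ge 0$ such that $$\Big|\int_\Omega v\,\Delta w\,dx\Big|\le M\|w\|_{H^1(\Omega)}\qquad\text{for all } w\in C_c^\infty(\Omega).$$ (a) If $v\in C_0(\Omega)$ and $\Delta v\in H^{-1}(\Omega)$, then $v\in H^1_0(\Omega)$. (b) Consequently, the variational solution $u_\varphi$ of the Dirichlet problem does not depend on the chosen extension: let $\varphi\in C(\partial\Omega)$ and let $\Phi_1,\Phi_2\in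 C(\overline\Omega)$ satisfy $\Phi_i|_{\partial\Omega}=\varphi$ and $\Delta\Phi_i\in H^{-1}(\Omega)$ for $i=1,2$. If, for $i=1,2$, the function $u_i$ is harmonic on $\Omega$ and $u_i=\Phi_i-v_i$ almost everywhere on $\Omega$, where $v_i\in H^1_0(\Omega)$ satisfies $$\int_\Omega\Phi_i\,\Delta w\,dx=-\int_\Omega\nabla v_i\cdot\nabla w\,dx\qquad\text{for all } w\in C_c^\infty(\Omega),$$ then $u_1=u_2$ on $\Omega$. -/

import Mathlib

open MeasureTheory Filter Set
open scoped Topology ContDiff Gradient Laplacian InnerProductSpace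

noncomputable section

/-- The Euclidean space `ℝᵈ`. -/
abbrev Eu (d : ℕ) : Type := EuclideanSpace ℝ (Fin d)

/-- `w ∈ C_c^∞(Ω)`, with `w` extended by zero to the whole space. -/
structure IsTestFunction {d : ℕ} (Ω : Set (Eu d)) (w : Eu d → ℝ) : Prop where
  smooth : ContDiff ℝ ∞ w
  compact : HasCompactSupport w
  support_subset : tsupport w ⊆ Ω

/-- `v ∈ C_0(Ω)` for a bounded open set `Ω`: `v` is continuous on `Ω` and vanishes at the boundary.
Only the values of `v` on `Ω` matter. -/
structure IsC0 {d : ℕ} (Ω : Set (Eu d)) (v : Eu d → ℝ) : Prop where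
  continuousOn : ContinuousOn v Ω
  tendsto_zero : ∀ z ∈ frontier Ω, Tendsto v (𝓝[Ω] z) (𝓝 0)

/-- `u ∈ H¹(Ω)` with weak gradient `g`: both are square integrable over `Ω`, and
`∫_Ω u ∇w = - ∫_Ω w g` (an identity of vectors, that is, one identity for each `∂_j`)
for all test functions `w`. -/
structure HasH1Gradient {d : ℕ} (Ω : Set (Eu d)) (u : Eu d → ℝ) (g : Eu d → Eu d) : Prop where
  memLp : MemLp u 2 (volume.restrict Ω)
  memLp_gradient : MemLp g 2 (volume.restrict Ω)
  integral_eq : ∀ w : Eu d → ℝ, IsTestFunction Ω w →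
    ∫ x in Ω, u x • ∇ w x = - ∫ x in Ω, w x • g x

/-- The norm of `H¹(Ω)`, evaluated at a function `u` with (weak or classical) gradient `g`. -/
def h1Norm {d : ℕ} (Ω : Set (Eu d)) (u : Eu d → ℝ) (g : Eu d → Eu d) : ℝ :=
  √((∫ x in Ω, u x ^ 2) + ∫ x in Ω, ‖g x‖ ^ 2)

/-- `u ∈ H¹₀(Ω)` with weak gradient `g`: `u ∈ H¹(Ω)` lies in the closure of `C_c^∞(Ω)` with respect
to the norm of `H¹(Ω)`. -/
structure HasH10Gradient {d : ℕ} (Ω : Set (Eu d)) (u : Eu d → ℝ) (g : Eu d → Eu d) : Prop where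
  hasH1Gradient : HasH1Gradient Ω u g
  mem_closure : ∀ ε : ℝ, 0 < ε → ∃ w : Eu d → ℝ, IsTestFunction Ω w ∧
    h1Norm Ω (fun x => u x - w x) (fun x => g x - ∇ w x) < ε

/-- `u ∈ H¹₀(Ω)`. -/
def MemH10 {d : ℕ} (Ω : Set (Eu d)) (u : Eu d → ℝ) : Prop :=
  ∃ g : Eu d → Eu d, HasH10Gradient Ω u g

/-- `Δv ∈ H⁻¹(Ω)`: the distributional Laplacian `w ↦ ∫_Ω v Δw` is bounded on `C_c^∞(Ω)` for the norm
of `H¹(Ω)`, that is, it extends to a continuous linear functional on `H¹₀(Ω)`. -/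
def LaplacianMemHNegOne {d : ℕ} (Ω : Set (Eu d)) (v : Eu d → ℝ) : Prop :=
  ∃ M : ℝ, 0 ≤ M ∧ ∀ w : Eu d → ℝ, IsTestFunction Ω w →
    |∫ x in Ω, v x * (Δ w) x| ≤ M * h1Norm Ω w (∇ w)

/-- `Φ ∈ C(Ω̄)` extends `φ`, a function on the boundary `∂Ω`, and `ΔΦ ∈ H⁻¹(Ω)`. -/
structure IsAdmissibleExtension {d : ℕ} (Ω : Set (Eu d)) (φ : frontier Ω → ℝ) (Φ : Eu d → ℝ) :
    Prop where
  continuousOn : ContinuousOn Φ (closure Ω)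
  extends_boundary : ∀ z : frontier Ω, Φ z = φ z
  laplacian_mem : LaplacianMemHNegOne Ω Φ

/-- `u` is the variational solution constructed from the extension `Φ`: `u` is harmonic on `Ω` and
`u = Φ - v` almost everywhere, where `v ∈ H¹₀(Ω)` satisfies
`∫_Ω Φ Δw = - ∫_Ω ∇v ∇w` for all test functions `w`. -/
def IsVariationalSolutionFrom {d : ℕ} (Ω : Set (Eu d)) (Φ u : Eu d → ℝ) : Prop :=
  InnerProductSpace.HarmonicOnNhd u Ω ∧
  ∃ (v : Eu d → ℝ) (g : Eu d → Eu d), HasH10Gradient Ω v g ∧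
    (∀ w : Eu d → ℝ, IsTestFunction Ω w →
      ∫ x in Ω, Φ x * (Δ w) x = - ∫ x in Ω, ⟪g x, ∇ w x⟫_ℝ) ∧
    ∀ᵐ x ∂(volume.restrict Ω), u x = Φ x - v x

end

/-!
Extend `v ∈ C_0(Ω)` by zero, let `u` be a mollification of it at distance less than `ε / 2`, and let
`f` be a smooth truncation with `f = 0` on `[-ε, ε]`, `0 ≤ f' ≤ 1` and `|f t - t| ≤ 2ε`. Then
`w = f ∘ u` is a test function uniformly close to `v`. Testing `Δu` with `w` itself gives
`∫ |∇w|² ≤ ∫ ∇u ⬝ ∇w = -∫ u Δw ≤ M ‖w‖`, because `|f' ∇u|² ≤ f' |∇u|²` and mollification does not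
increase the bound `M` of `Δv` when the small translates of `w` are still supported in `Ω`. So `v`
is the `L²` limit of test functions bounded in `H¹`, and it lies in `H¹₀(Ω)` because bounded closed
convex sets in a Hilbert space have closed images under continuous linear maps.

The difference of two extensions of `φ` lies in `C_0(Ω)`, hence in `H¹₀(Ω)`, so the difference of
the two solutions is a weakly harmonic element of `H¹₀(Ω)`, which vanishes by Poincaré's inequality.
-/

section WeakCompactness

variable {X Y H : Type*} [NormedAddCommGroup X] [NormedSpace ℝ X] [NormedAddCommGroup Y]
  [NormedSpace ℝ Y] [NormedAddCommGroup H] [InnerProductSpace ℝ H] [CompleteSpace H]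

lemma inclusionInDoubleDual_surjective :
    Function.Surjective (NormedSpace.inclusionInDoubleDual ℝ H) := fun Λ => by
  obtain ⟨x, hx⟩ := (InnerProductSpace.toDual ℝ H).surjective
    (Λ.comp isBoundedBilinearMap_inner.toContinuousLinearMap)
  refine ⟨x, ContinuousLinearMap.ext fun ℓ => ?_⟩
  obtain ⟨y, rfl⟩ := (InnerProductSpace.toDual ℝ H).surjective ℓ
  exact (real_inner_comm x y).trans (DFunLike.congr_fun hx y)

lemma isCompact_toWeakSpace_image_of_reflexive
    (hX : Function.Surjective (NormedSpace.inclusionInDoubleDual ℝ X)) {S : Set X}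
    (hconv : Convex ℝ S) (hclosed : IsClosed S) (hbdd : Bornology.IsBounded S) :
    IsCompact (toWeakSpace ℝ X '' S) := by
  have hclosure := hconv.toWeakSpace_closure ℝ
  rw [hclosed.closure_eq] at hclosure
  rw [hclosure]
  refine NormedSpace.isCompact_closure_of_isBounded ℝ X _ ?_ fun Λ _ => ?_
  · rwa [preimage_image_eq _ (toWeakSpace ℝ X).injective]
  · exact (hX (WeakDual.toStrongDual Λ)).imp fun _ hx => hx

lemma isClosed_image_of_reflexive
    (hX : Function.Surjective (NormedSpace.inclusionInDoubleDual ℝ X)) {S : Set X}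
    (hconv : Convex ℝ S) (hclosed : IsClosed S) (hbdd : Bornology.IsBounded S) (T : X →L[ℝ] Y) :
    IsClosed (T '' S) := by
  have hcompact := (isCompact_toWeakSpace_image_of_reflexive hX hconv hclosed hbdd).image
    (WeakSpace.map T).continuous
  have hpre : T '' S = toWeakSpaceCLM ℝ Y ⁻¹' (WeakSpace.map T '' (toWeakSpace ℝ X '' S)) := by
    rw [image_image]
    exact (preimage_image_eq _ (toWeakSpaceCLM_bijective (𝕜 := ℝ)).injective).symm.trans
      (congrArg _ (image_image _ _ _))
  rw [hpre]
  exact hcompact.isClosed.preimage (toWeakSpaceCLM ℝ Y).continuous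

end WeakCompactness

section SquareIntegrable

variable {α E : Type*} [MeasurableSpace α] {μ : Measure α} [NormedAddCommGroup E]
  [InnerProductSpace ℝ E] {f g : α → E}

lemma inner_toLp (hf : MemLp f 2 μ) (hg : MemLp g 2 μ) :
    ⟪hf.toLp f, hg.toLp g⟫_ℝ = ∫ x, ⟪f x, g x⟫_ℝ ∂μ := by
  rw [L2.inner_def]
  refine integral_congr_ae ?_
  filter_upwards [hf.coeFn_toLp, hg.coeFn_toLp] with x hfx hgx
  rw [hfx, hgx]

lemma integrable_inner_of_memLp (hf : MemLp f 2 μ) (hg : MemLp g 2 μ) :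
    Integrable (fun x => ⟪f x, g x⟫_ℝ) μ := by
  refine (L2.integrable_inner (𝕜 := ℝ) (hf.toLp f) (hg.toLp g)).congr ?_
  filter_upwards [hf.coeFn_toLp, hg.coeFn_toLp] with x hfx hgx
  rw [hfx, hgx]

lemma norm_toLp_sq (hf : MemLp f 2 μ) : ‖hf.toLp f‖ ^ 2 = ∫ x, ‖f x‖ ^ 2 ∂μ := by
  simp_rw [← real_inner_self_eq_norm_sq, inner_toLp]

lemma setIntegral_sq_le_of_abs_le {u : α → ℝ} {s : Set α} {C : ℝ} (hs : μ s < ⊤)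
    (hu : ∀ x ∈ s, |u x| ≤ C) : ∫ x in s, u x ^ 2 ∂μ ≤ C ^ 2 * μ.real s := by
  refine (Real.le_norm_self _).trans (norm_setIntegral_le_of_norm_le_const hs fun x hx => ?_)
  rw [norm_pow, Real.norm_eq_abs]
  exact pow_le_pow_left₀ (abs_nonneg _) (hu x hx) 2

end SquareIntegrable

section Gradient

variable {E : Type*} [NormedAddCommGroup E] [InnerProductSpace ℝ E] [CompleteSpace E]
  {u w : E → ℝ}

lemma contDiff_gradient {n m : WithTop ℕ∞} (hw : ContDiff ℝ n w) (hmn : m + 1 ≤ n) :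
    ContDiff ℝ m (∇ w) :=
  (InnerProductSpace.toDual ℝ E).symm.contDiff.comp (hw.fderiv_right hmn)

lemma real_inner_gradient_right (w : E → ℝ) (x e : E) : ⟪e, ∇ w x⟫_ℝ = fderiv ℝ w x e := by
  rw [inner_gradient_right, conj_trivial]

lemma support_gradient_subset (w : E → ℝ) : Function.support (∇ w) ⊆ tsupport w := by
  refine Subset.trans (fun x hx => ?_) (support_fderiv_subset ℝ)
  simpa [gradient] using hx

lemma hasCompactSupport_gradient (hw : HasCompactSupport w) : HasCompactSupport (∇ w) :=
  hw.mono' (support_gradient_subset w)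

lemma gradient_fun_add {x : E} (hu : DifferentiableAt ℝ u x) (hw : DifferentiableAt ℝ w x) :
    ∇ (fun y => u y + w y) x = ∇ u x + ∇ w x := by
  simp only [gradient, fderiv_fun_add hu hw, map_add]

lemma gradient_fun_const_mul {x : E} (c : ℝ) (hw : DifferentiableAt ℝ w x) :
    ∇ (fun y => c * w y) x = c • ∇ w x := by
  simp [gradient, fderiv_const_mul hw]

lemma gradient_comp_add_right (w : E → ℝ) (y x : E) :
    ∇ (fun z => w (z + y)) x = ∇ w (x + y) := by
  simp only [gradient, fderiv_comp_add_right]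

lemma gradient_comp_of_hasDerivAt {f : ℝ → ℝ} {f' : ℝ} {x : E} (hf : HasDerivAt f f' (u x))
    (hu : DifferentiableAt ℝ u x) : ∇ (fun y => f (u y)) x = f' • ∇ u x := by
  have h : fderiv ℝ (fun y => f (u y)) x = f' • fderiv ℝ u x :=
    (hf.comp_hasFDerivAt x hu.hasFDerivAt).fderiv
  simp [gradient, h]

end Gradient

section Laplacian

variable {E : Type*} [NormedAddCommGroup E] [InnerProductSpace ℝ E] [FiniteDimensional ℝ E]
  {w : E → ℝ}

lemma laplacian_eq_sum_fderiv_fderiv {ι : Type*} [Fintype ι] (b : OrthonormalBasis ι ℝ E)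
    (hw : ContDiff ℝ 2 w) (x : E) :
    (Δ w) x = ∑ i, fderiv ℝ (fun y => fderiv ℝ w y (b i)) x (b i) := by
  rw [InnerProductSpace.laplacian_eq_iteratedFDeriv_orthonormalBasis w b]
  refine Finset.sum_congr rfl fun i _ => ?_
  have hw' : DifferentiableAt ℝ (fderiv ℝ w) x :=
    (hw.fderiv_right (m := 1) (by norm_num)).differentiable one_ne_zero x
  rw [iteratedFDeriv_two_apply, fderiv_clm_apply hw' (differentiableAt_const _)]
  simp

lemma continuous_laplacian (hw : ContDiff ℝ 2 w) : Continuous (Δ w) := by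
  rw [InnerProductSpace.laplacian_eq_iteratedFDeriv_orthonormalBasis w
    (stdOrthonormalBasis ℝ E)]
  exact continuous_finsetSum _ fun i _ =>
    (hw.continuous_iteratedFDeriv le_rfl).eval_const _

lemma support_laplacian_subset (w : E → ℝ) : Function.support (Δ w) ⊆ tsupport w := by
  refine Function.support_subset_iff'.2 fun x hx => ?_
  have hzero : w =ᶠ[𝓝 x] fun _ => (0 : ℝ) := notMem_tsupport_iff_eventuallyEq.1 hx
  simp [(InnerProductSpace.laplacian_congr_nhds hzero).eq_of_nhds]

lemma hasCompactSupport_laplacian (hw : HasCompactSupport w) : HasCompactSupport (Δ w) :=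
  hw.mono' (support_laplacian_subset w)

lemma laplacian_comp_add_right (w : E → ℝ) (y x : E) :
    (Δ fun z => w (z + y)) x = (Δ w) (x + y) := by
  simp_rw [InnerProductSpace.laplacian_eq_iteratedFDeriv_stdOrthonormalBasis,
    iteratedFDeriv_comp_add_right]

end Laplacian

section TestFunction

variable {d : ℕ} {Ω : Set (Eu d)} {u w : Eu d → ℝ}

namespace IsTestFunction

lemma contDiff_two (hw : IsTestFunction Ω w) : ContDiff ℝ 2 w :=
  contDiff_infty.1 hw.smooth 2

lemma differentiable (hw : IsTestFunction Ω w) : Differentiable ℝ w :=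
  hw.smooth.differentiable (by simp)

lemma memLp (hw : IsTestFunction Ω w) (μ : Measure (Eu d)) [IsFiniteMeasureOnCompacts μ] :
    MemLp w 2 μ :=
  hw.smooth.continuous.memLp_of_hasCompactSupport hw.compact

lemma memLp_gradient (hw : IsTestFunction Ω w) (μ : Measure (Eu d))
    [IsFiniteMeasureOnCompacts μ] : MemLp (∇ w) 2 μ :=
  (contDiff_gradient (m := ∞) hw.smooth (by simp)).continuous.memLp_of_hasCompactSupport
    (hasCompactSupport_gradient hw.compact)

lemma eq_zero_of_notMem (hw : IsTestFunction Ω w) {x : Eu d} (hx : x ∉ Ω) : w x = 0 :=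
  image_eq_zero_of_notMem_tsupport fun h => hx (hw.support_subset h)

lemma gradient_eq_zero_of_notMem (hw : IsTestFunction Ω w) {x : Eu d} (hx : x ∉ Ω) :
    ∇ w x = 0 :=
  Function.notMem_support.1 fun h => hx (hw.support_subset (support_gradient_subset w h))

lemma laplacian_eq_zero_of_notMem (hw : IsTestFunction Ω w) {x : Eu d} (hx : x ∉ Ω) :
    (Δ w) x = 0 :=
  Function.notMem_support.1 fun h => hx (hw.support_subset (support_laplacian_subset w h))

lemma setIntegral_sq (hw : IsTestFunction Ω w) : ∫ x in Ω, w x ^ 2 = ∫ x, w x ^ 2 :=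
  setIntegral_eq_integral_of_forall_compl_eq_zero fun x hx => by simp [hw.eq_zero_of_notMem hx]

lemma setIntegral_norm_gradient_sq (hw : IsTestFunction Ω w) :
    ∫ x in Ω, ‖∇ w x‖ ^ 2 = ∫ x, ‖∇ w x‖ ^ 2 :=
  setIntegral_eq_integral_of_forall_compl_eq_zero fun x hx => by
    simp [hw.gradient_eq_zero_of_notMem hx]

protected lemma zero (Ω : Set (Eu d)) : IsTestFunction Ω (fun _ => (0 : ℝ)) where
  smooth := contDiff_const
  compact := HasCompactSupport.zero
  support_subset := by simp [tsupport]

protected lemma add (hu : IsTestFunction Ω u) (hw : IsTestFunction Ω w) :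
    IsTestFunction Ω (fun x => u x + w x) where
  smooth := hu.smooth.add hw.smooth
  compact := hu.compact.add hw.compact
  support_subset := (tsupport_add u w).trans (union_subset hu.support_subset hw.support_subset)

lemma smooth_mul (hw : IsTestFunction Ω w) (hu : ContDiff ℝ ∞ u) :
    IsTestFunction Ω (fun x => u x * w x) where
  smooth := hu.mul hw.smooth
  compact := hw.compact.mul_left
  support_subset := tsupport_mul_subset_right.trans hw.support_subset

lemma fderiv_apply (hw : IsTestFunction Ω w) (e : Eu d) :
    IsTestFunction Ω (fun x => fderiv ℝ w x e) where
  smooth := (hw.smooth.fderiv_right (by simp)).clm_apply contDiff_const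
  compact := hw.compact.fderiv_apply ℝ e
  support_subset := (tsupport_fderiv_apply_subset ℝ e).trans hw.support_subset

lemma comp_add_right {Ω' : Set (Eu d)} (hw : IsTestFunction Ω w) (y : Eu d)
    (h : ∀ x, x + y ∈ tsupport w → x ∈ Ω') : IsTestFunction Ω' (fun x => w (x + y)) where
  smooth := hw.smooth.comp (contDiff_id.add contDiff_const)
  compact := hw.compact.comp_homeomorph (Homeomorph.addRight y)
  support_subset :=
    (tsupport_comp_subset_preimage w (Homeomorph.addRight y).continuous).trans h

lemma h1Norm_comp_add_right {Ω' : Set (Eu d)} (hw : IsTestFunction Ω w) {y : Eu d}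
    (hwy : IsTestFunction Ω' fun x => w (x + y)) :
    h1Norm Ω' (fun x => w (x + y)) (∇ fun x => w (x + y)) = h1Norm Ω w (∇ w) := by
  rw [h1Norm, h1Norm, hwy.setIntegral_sq, hwy.setIntegral_norm_gradient_sq, hw.setIntegral_sq,
    hw.setIntegral_norm_gradient_sq]
  simp_rw [gradient_comp_add_right]
  rw [integral_add_right_eq_self (fun x => w x ^ 2) y,
    integral_add_right_eq_self (fun x => ‖∇ w x‖ ^ 2) y]

lemma integral_mul_fderiv_eq_neg (hw : IsTestFunction Ω w) (hu : ContDiff ℝ 1 u) (e : Eu d) :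
    ∫ x, u x * fderiv ℝ w x e = - ∫ x, fderiv ℝ u x e * w x := by
  have hu' : Continuous fun x => fderiv ℝ u x e :=
    (hu.continuous_fderiv one_ne_zero).clm_apply continuous_const
  have hw' := hw.fderiv_apply e
  exact integral_mul_fderiv_eq_neg_fderiv_mul_of_integrable
    ((hu'.mul hw.smooth.continuous).integrable_of_hasCompactSupport hw.compact.mul_left)
    ((hu.continuous.mul hw'.smooth.continuous).integrable_of_hasCompactSupport
      hw'.compact.mul_left)
    ((hu.continuous.mul hw.smooth.continuous).integrable_of_hasCompactSupport
      hw.compact.mul_left)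
    (fun x _ => hu.differentiable one_ne_zero x) (fun x _ => hw.differentiable x)

end IsTestFunction

end TestFunction

section WeakGradient

variable {d : ℕ} {Ω : Set (Eu d)} {u w : Eu d → ℝ} {g : Eu d → Eu d}

lemma hasH1Gradient_iff_integral_fderiv (hu : MemLp u 2 (volume.restrict Ω))
    (hg : MemLp g 2 (volume.restrict Ω)) :
    HasH1Gradient Ω u g ↔ ∀ w : Eu d → ℝ, IsTestFunction Ω w → ∀ e : Eu d,
      ∫ x in Ω, u x * fderiv ℝ w x e = - ∫ x in Ω, w x * ⟪e, g x⟫_ℝ := by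
  have integral_eq_iff (w : Eu d → ℝ) (hw : IsTestFunction Ω w) :
      (∫ x in Ω, u x • ∇ w x = - ∫ x in Ω, w x • g x) ↔ ∀ e : Eu d,
        ∫ x in Ω, u x * fderiv ℝ w x e = - ∫ x in Ω, w x * ⟪e, g x⟫_ℝ := by
    have integrable_left : Integrable (fun x => u x • ∇ w x) (volume.restrict Ω) :=
      memLp_one_iff_integrable.1 ((hw.memLp_gradient _).smul hu)
    have integrable_right : Integrable (fun x => w x • g x) (volume.restrict Ω) :=
      memLp_one_iff_integrable.1 (hg.smul (hw.memLp _))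
    rw [ext_iff_inner_left ℝ]
    refine forall_congr' fun e => ?_
    rw [inner_neg_right, ← integral_inner integrable_left, ← integral_inner integrable_right]
    simp_rw [inner_smul_right, real_inner_gradient_right]
  exact ⟨fun h w hw => (integral_eq_iff w hw).1 (h.integral_eq w hw),
    fun h => ⟨hu, hg, fun w hw => (integral_eq_iff w hw).2 (h w hw)⟩⟩

lemma hasH1Gradient_gradient (hu : ContDiff ℝ 1 u) (hc : HasCompactSupport u)
    (Ω : Set (Eu d)) : HasH1Gradient Ω u (∇ u) := by
  have hgrad : Continuous (∇ u) := (contDiff_gradient (m := 0) hu (by simp)).continuous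
  refine (hasH1Gradient_iff_integral_fderiv (hu.continuous.memLp_of_hasCompactSupport hc)
    (hgrad.memLp_of_hasCompactSupport (hasCompactSupport_gradient hc))).2 fun w hw e => ?_
  rw [setIntegral_eq_integral_of_forall_compl_eq_zero fun x hx => by
      rw [(hw.fderiv_apply e).eq_zero_of_notMem hx, mul_zero],
    setIntegral_eq_integral_of_forall_compl_eq_zero fun x hx => by
      rw [hw.eq_zero_of_notMem hx, zero_mul],
    hw.integral_mul_fderiv_eq_neg hu]
  simp_rw [real_inner_gradient_right, mul_comm]

lemma HasH1Gradient.integral_mul_laplacian (hu : HasH1Gradient Ω u g)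
    (hw : IsTestFunction Ω w) :
    ∫ x in Ω, u x * (Δ w) x = - ∫ x in Ω, ⟪g x, ∇ w x⟫_ℝ := by
  let b := EuclideanSpace.basisFun (Fin d) ℝ
  have htest (i : Fin d) := hw.fderiv_apply (b i)
  have hint (i : Fin d) : Integrable
      (fun x => u x * fderiv ℝ (fun y => fderiv ℝ w y (b i)) x (b i)) (volume.restrict Ω) :=
    hu.memLp.integrable_mul (((htest i).fderiv_apply _).memLp _)
  have hint' (i : Fin d) :
      Integrable (fun x => fderiv ℝ w x (b i) * ⟪b i, g x⟫_ℝ) (volume.restrict Ω) :=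
    ((htest i).memLp _).integrable_mul ((innerSL ℝ (b i)).comp_memLp' hu.memLp_gradient)
  have integral_eq (i : Fin d) :=
    (hasH1Gradient_iff_integral_fderiv hu.memLp hu.memLp_gradient).1 hu _ (htest i) (b i)
  have inner_eq (x : Eu d) : ⟪g x, ∇ w x⟫_ℝ = ∑ i, fderiv ℝ w x (b i) * ⟪b i, g x⟫_ℝ := by
    rw [← b.sum_inner_mul_inner]
    exact Finset.sum_congr rfl fun i _ => by
      rw [real_inner_gradient_right, real_inner_comm, mul_comm]
  simp_rw [laplacian_eq_sum_fderiv_fderiv b hw.contDiff_two, Finset.mul_sum, inner_eq]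
  rw [integral_finsetSum _ fun i _ => hint i, integral_finsetSum _ fun i _ => hint' i]
  simp_rw [integral_eq, Finset.sum_neg_distrib]

end WeakGradient

section Poincare

variable {d : ℕ} {Ω : Set (Eu d)} {w : Eu d → ℝ} {e : Eu d}

namespace IsTestFunction

lemma integral_sq_eq_neg (hw : IsTestFunction Ω w) (he : ‖e‖ = 1) :
    ∫ x, w x ^ 2 = - ∫ x, ⟪e, x⟫_ℝ * (2 * w x * fderiv ℝ w x e) := by
  have h := (hw.smooth_mul hw.smooth).integral_mul_fderiv_eq_neg (innerSL ℝ e).contDiff e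
  have fderiv_mul_self (x : Eu d) :
      fderiv ℝ (fun y => w y * w y) x e = 2 * w x * fderiv ℝ w x e := by
    rw [fderiv_fun_mul (hw.differentiable x) (hw.differentiable x)]
    simp only [add_apply, smul_apply, smul_eq_mul]
    ring
  simp_rw [fderiv_mul_self, ContinuousLinearMap.fderiv, innerSL_apply_apply,
    real_inner_self_eq_norm_sq, he, one_pow, one_mul, ← sq] at h
  rw [h, neg_neg]

lemma setIntegral_sq_le {R : ℝ} (hw : IsTestFunction Ω w) (he : ‖e‖ = 1)
    (hR : ∀ x ∈ Ω, |⟪e, x⟫_ℝ| ≤ R) :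
    ∫ x in Ω, w x ^ 2 ≤ (2 * R) ^ 2 * ∫ x in Ω, ‖∇ w x‖ ^ 2 := by
  have pointwise (x : Eu d) : -(⟪e, x⟫_ℝ * (2 * w x * fderiv ℝ w x e)) ≤
      w x ^ 2 / 2 + 2 * R ^ 2 * ‖∇ w x‖ ^ 2 := by
    by_cases hx : x ∈ Ω
    · have hderiv : |fderiv ℝ w x e| ≤ ‖∇ w x‖ := by
        simpa [real_inner_gradient_right, he] using abs_real_inner_le_norm e (∇ w x)
      have hsq : (⟪e, x⟫_ℝ * fderiv ℝ w x e) ^ 2 ≤ (R * ‖∇ w x‖) ^ 2 := by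
        rw [← sq_abs, abs_mul]
        gcongr
        · exact (abs_nonneg _).trans (hR x hx)
        · exact hR x hx
      nlinarith [sq_nonneg (w x + 2 * (⟪e, x⟫_ℝ * fderiv ℝ w x e))]
    · rw [hw.eq_zero_of_notMem hx]
      simp only [mul_zero, zero_mul, neg_zero]
      positivity
  have integrable_left : Integrable fun x => -(⟪e, x⟫_ℝ * (2 * w x * fderiv ℝ w x e)) :=
    ((((hw.fderiv_apply e).smooth_mul (contDiff_const.mul hw.smooth)).smooth_mul
      (innerSL ℝ e).contDiff).smooth.continuous.integrable_of_hasCompactSupport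
      (hw.fderiv_apply e).compact.mul_left.mul_left).neg
  have integrable_sq : Integrable fun x => w x ^ 2 / 2 := (hw.memLp _).integrable_sq.div_const 2
  have integrable_grad : Integrable fun x => 2 * R ^ 2 * ‖∇ w x‖ ^ 2 :=
    (hw.memLp_gradient _).norm.integrable_sq.const_mul _
  have h := integral_mono integrable_left (integrable_sq.add integrable_grad) pointwise
  rw [integral_neg, ← hw.integral_sq_eq_neg he] at h
  simp only [Pi.add_apply] at h
  rw [integral_add integrable_sq integrable_grad, integral_div, integral_const_mul] at h
  rw [hw.setIntegral_sq, hw.setIntegral_norm_gradient_sq]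
  linarith

end IsTestFunction

end Poincare

section H1Pair

variable {d : ℕ} {Ω : Set (Eu d)} {u u' w : Eu d → ℝ} {g g' : Eu d → Eu d}

/-- `L²(Ω) × L²(Ω; ℝᵈ)` as a Hilbert space. It contains `H¹(Ω)`, with `u` represented by the pair
`(u, ∇u)` and with the norm of `H¹(Ω)`. -/
abbrev H1Pair (Ω : Set (Eu d)) : Type :=
  WithLp 2 (Lp ℝ 2 (volume.restrict Ω) × Lp (Eu d) 2 (volume.restrict Ω))

/-- The element of `H1Pair Ω` represented by `(u, g)`; it lies in `H¹(Ω)` when `g` is the weak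
gradient of `u`. -/
noncomputable def h1Pair (hu : MemLp u 2 (volume.restrict Ω))
    (hg : MemLp g 2 (volume.restrict Ω)) : H1Pair Ω :=
  WithLp.toLp 2 (hu.toLp u, hg.toLp g)

lemma h1Pair_fst (hu : MemLp u 2 (volume.restrict Ω)) (hg : MemLp g 2 (volume.restrict Ω)) :
    (h1Pair hu hg).fst = hu.toLp u := rfl

lemma h1Pair_snd (hu : MemLp u 2 (volume.restrict Ω)) (hg : MemLp g 2 (volume.restrict Ω)) :
    (h1Pair hu hg).snd = hg.toLp g := rfl

lemma h1Pair_add (hu : MemLp u 2 (volume.restrict Ω)) (hg : MemLp g 2 (volume.restrict Ω))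
    (hu' : MemLp u' 2 (volume.restrict Ω)) (hg' : MemLp g' 2 (volume.restrict Ω)) :
    h1Pair (hu.add hu') (hg.add hg') = h1Pair hu hg + h1Pair hu' hg' := rfl

lemma h1Pair_sub (hu : MemLp u 2 (volume.restrict Ω)) (hg : MemLp g 2 (volume.restrict Ω))
    (hu' : MemLp u' 2 (volume.restrict Ω)) (hg' : MemLp g' 2 (volume.restrict Ω)) :
    h1Pair (hu.sub hu') (hg.sub hg') = h1Pair hu hg - h1Pair hu' hg' := rfl

lemma h1Pair_const_smul (c : ℝ) (hu : MemLp u 2 (volume.restrict Ω))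
    (hg : MemLp g 2 (volume.restrict Ω)) :
    h1Pair (hu.const_smul c) (hg.const_smul c) = c • h1Pair hu hg := rfl

lemma inner_h1Pair (hu : MemLp u 2 (volume.restrict Ω)) (hg : MemLp g 2 (volume.restrict Ω))
    (hu' : MemLp u' 2 (volume.restrict Ω)) (hg' : MemLp g' 2 (volume.restrict Ω)) :
    ⟪h1Pair hu hg, h1Pair hu' hg'⟫_ℝ =
      (∫ x in Ω, u x * u' x) + ∫ x in Ω, ⟪g x, g' x⟫_ℝ := by
  rw [WithLp.prod_inner_apply, h1Pair, h1Pair, inner_toLp, inner_toLp]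
  simp only [RCLike.inner_apply, conj_trivial, mul_comm]

lemma norm_h1Pair (hu : MemLp u 2 (volume.restrict Ω)) (hg : MemLp g 2 (volume.restrict Ω)) :
    ‖h1Pair hu hg‖ = h1Norm Ω u g := by
  rw [norm_eq_sqrt_real_inner, inner_h1Pair, h1Norm]
  simp_rw [real_inner_self_eq_norm_sq, sq]

/-- `C_c^∞(Ω)` as a subspace of `H1Pair Ω`; its closure is `H¹₀(Ω)`. -/
noncomputable def testPairs (Ω : Set (Eu d)) : Submodule ℝ (H1Pair Ω) where
  carrier := {z | ∃ (w : Eu d → ℝ) (hw : IsTestFunction Ω w),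
    z = h1Pair (hw.memLp _) (hw.memLp_gradient _)}
  zero_mem' := by
    refine ⟨_, IsTestFunction.zero Ω, ?_⟩
    simp only [gradient_fun_const']
    rfl
  add_mem' := by
    rintro _ _ ⟨w, hw, rfl⟩ ⟨w', hw', rfl⟩
    refine ⟨_, hw.add hw', ?_⟩
    have hgrad : (∇ fun x => w x + w' x) = ∇ w + ∇ w' :=
      funext fun x => gradient_fun_add (hw.differentiable x) (hw'.differentiable x)
    simp only [← h1Pair_add, hgrad]
  smul_mem' := by
    rintro c _ ⟨w, hw, rfl⟩
    refine ⟨_, hw.smooth_mul (contDiff_const (c := c)), ?_⟩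
    have hgrad : (∇ fun x => c * w x) = c • ∇ w :=
      funext fun x => gradient_fun_const_mul c (hw.differentiable x)
    simp only [← h1Pair_const_smul, hgrad]

lemma IsTestFunction.h1Pair_mem_testPairs (hw : IsTestFunction Ω w) :
    h1Pair (hw.memLp _) (hw.memLp_gradient _) ∈ testPairs Ω :=
  ⟨w, hw, rfl⟩

lemma hasH1Gradient_iff_inner_h1Pair (hu : MemLp u 2 (volume.restrict Ω))
    (hg : MemLp g 2 (volume.restrict Ω)) :
    HasH1Gradient Ω u g ↔ ∀ (w : Eu d → ℝ) (hw : IsTestFunction Ω w) (e : Eu d),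
      ⟪h1Pair ((hw.fderiv_apply e).memLp _)
        ((ContinuousLinearMap.toSpanSingleton ℝ e).comp_memLp' (hw.memLp _)),
        h1Pair hu hg⟫_ℝ = 0 := by
  rw [hasH1Gradient_iff_integral_fderiv hu hg]
  refine forall₃_congr fun w hw e => ?_
  rw [inner_h1Pair, ← eq_neg_iff_add_eq_zero]
  simp [real_inner_smul_left, mul_comm]

lemma hasH1Gradient_of_mem_closure (hu : MemLp u 2 (volume.restrict Ω))
    (hg : MemLp g 2 (volume.restrict Ω))
    (h : h1Pair hu hg ∈ (testPairs Ω).topologicalClosure) : HasH1Gradient Ω u g := by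
  refine (hasH1Gradient_iff_inner_h1Pair hu hg).2 fun w hw e => ?_
  refine closure_minimal ?_ (isClosed_eq (continuous_const.inner continuous_id) continuous_const) h
  rintro _ ⟨w', hw', rfl⟩
  exact (hasH1Gradient_iff_inner_h1Pair _ _).1
    (hasH1Gradient_gradient (contDiff_infty.1 hw'.smooth 1) hw'.compact Ω) w hw e

lemma hasH10Gradient_iff_mem_closure (hu : MemLp u 2 (volume.restrict Ω))
    (hg : MemLp g 2 (volume.restrict Ω)) :
    HasH10Gradient Ω u g ↔ h1Pair hu hg ∈ (testPairs Ω).topologicalClosure := by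
  have dist_eq {w : Eu d → ℝ} (hw : IsTestFunction Ω w) :
      dist (h1Pair hu hg) (h1Pair (hw.memLp _) (hw.memLp_gradient _)) =
        h1Norm Ω (fun x => u x - w x) (fun x => g x - ∇ w x) := by
    rw [dist_eq_norm, ← h1Pair_sub, norm_h1Pair]
    rfl
  constructor
  · intro h
    refine Metric.mem_closure_iff.2 fun ε hε => ?_
    obtain ⟨w, hw, hlt⟩ := h.mem_closure ε hε
    exact ⟨_, hw.h1Pair_mem_testPairs, (dist_eq hw).trans_lt hlt⟩
  · intro h
    refine ⟨hasH1Gradient_of_mem_closure hu hg h, fun ε hε => ?_⟩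
    obtain ⟨_, ⟨w, hw, rfl⟩, hlt⟩ := Metric.mem_closure_iff.1 h ε hε
    exact ⟨w, hw, (dist_eq hw).symm.trans_lt hlt⟩

lemma norm_fst_sq_le_of_mem_closure {e : Eu d} {R : ℝ} (he : ‖e‖ = 1)
    (hR : ∀ x ∈ Ω, |⟪e, x⟫_ℝ| ≤ R) {z : H1Pair Ω}
    (hz : z ∈ (testPairs Ω).topologicalClosure) : ‖z.fst‖ ^ 2 ≤ (2 * R) ^ 2 * ‖z.snd‖ ^ 2 := by
  have hfst : Continuous fun z : H1Pair Ω => ‖z.fst‖ ^ 2 :=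
    (WithLp.fstL 2 ℝ _ _).continuous.norm.pow 2
  have hsnd : Continuous fun z : H1Pair Ω => (2 * R) ^ 2 * ‖z.snd‖ ^ 2 :=
    continuous_const.mul ((WithLp.sndL 2 ℝ _ _).continuous.norm.pow 2)
  refine closure_minimal ?_ (isClosed_le hfst hsnd) hz
  rintro _ ⟨w, hw, rfl⟩
  simpa only [mem_ofPred_eq, h1Pair_fst, h1Pair_snd, norm_toLp_sq, Real.norm_eq_abs, sq_abs]
    using hw.setIntegral_sq_le he hR

namespace HasH10Gradient

lemma sub (h : HasH10Gradient Ω u g) (h' : HasH10Gradient Ω u' g') :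
    HasH10Gradient Ω (u - u') (g - g') := by
  have hH1 := h.hasH1Gradient
  have hH1' := h'.hasH1Gradient
  rw [hasH10Gradient_iff_mem_closure hH1.memLp hH1.memLp_gradient] at h
  rw [hasH10Gradient_iff_mem_closure hH1'.memLp hH1'.memLp_gradient] at h'
  rw [hasH10Gradient_iff_mem_closure (hH1.memLp.sub hH1'.memLp)
    (hH1.memLp_gradient.sub hH1'.memLp_gradient),
    h1Pair_sub hH1.memLp hH1.memLp_gradient hH1'.memLp hH1'.memLp_gradient]
  exact Submodule.sub_mem _ h h'

lemma gradient_ae_eq_zero (h : HasH10Gradient Ω u g)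
    (hharm : ∀ w : Eu d → ℝ, IsTestFunction Ω w → ∫ x in Ω, ⟪g x, ∇ w x⟫_ℝ = 0) :
    g =ᵐ[volume.restrict Ω] 0 := by
  have hg := h.hasH1Gradient.memLp_gradient
  have hmem := (hasH10Gradient_iff_mem_closure h.hasH1Gradient.memLp hg).1 h
  have hclosed : IsClosed {z : H1Pair Ω | ⟪hg.toLp g, z.snd⟫_ℝ = 0} :=
    isClosed_eq (continuous_const.inner (WithLp.sndL 2 ℝ _ _).continuous) continuous_const
  have hself : ⟪hg.toLp g, hg.toLp g⟫_ℝ = 0 := by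
    refine closure_minimal ?_ hclosed hmem
    rintro _ ⟨w, hw, rfl⟩
    rw [mem_ofPred_eq, h1Pair_snd, inner_toLp, hharm w hw]
  exact (MemLp.toLp_eq_toLp_iff hg MemLp.zero').1 (inner_self_eq_zero.1 hself)

lemma ae_eq_zero {e : Eu d} {R : ℝ} (h : HasH10Gradient Ω u g) (he : ‖e‖ = 1)
    (hR : ∀ x ∈ Ω, |⟪e, x⟫_ℝ| ≤ R) (hg0 : g =ᵐ[volume.restrict Ω] 0) :
    u =ᵐ[volume.restrict Ω] 0 := by
  have hu := h.hasH1Gradient.memLp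
  have hg := h.hasH1Gradient.memLp_gradient
  have hle := norm_fst_sq_le_of_mem_closure he hR ((hasH10Gradient_iff_mem_closure hu hg).1 h)
  have hsnd : hg.toLp g = 0 := (MemLp.toLp_eq_toLp_iff hg MemLp.zero').2 hg0
  rw [h1Pair_fst, h1Pair_snd, hsnd, norm_zero, zero_pow two_ne_zero, mul_zero] at hle
  have hfst : hu.toLp u = 0 :=
    norm_eq_zero.1 (pow_eq_zero_iff two_ne_zero |>.1 (le_antisymm hle (sq_nonneg _)))
  exact (MemLp.toLp_eq_toLp_iff hu MemLp.zero').1 hfst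

end HasH10Gradient

lemma memH10_iff_mem_image (hu : MemLp u 2 (volume.restrict Ω)) :
    MemH10 Ω u ↔ hu.toLp u ∈
      WithLp.fstL 2 ℝ _ _ '' ((testPairs Ω).topologicalClosure : Set (H1Pair Ω)) := by
  constructor
  · rintro ⟨g, hg⟩
    exact ⟨_, (hasH10Gradient_iff_mem_closure hu hg.hasH1Gradient.memLp_gradient).1 hg, rfl⟩
  · rintro ⟨z, hz, hzu⟩
    refine ⟨z.snd, (hasH10Gradient_iff_mem_closure hu (Lp.memLp z.snd)).2 ?_⟩
    rwa [h1Pair, Lp.toLp_coeFn, ← hzu]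

lemma memH10_of_bounded_approx {C : ℝ} (hu : MemLp u 2 (volume.restrict Ω))
    (h : ∀ ε : ℝ, 0 < ε → ∃ w : Eu d → ℝ, IsTestFunction Ω w ∧ h1Norm Ω w (∇ w) ≤ C ∧
      ∫ x in Ω, (w x - u x) ^ 2 ≤ ε ^ 2) : MemH10 Ω u := by
  let S : Set (H1Pair Ω) := (testPairs Ω).topologicalClosure ∩ Metric.closedBall 0 C
  have hclosed : IsClosed (WithLp.fstL 2 ℝ _ _ '' S) :=
    isClosed_image_of_reflexive inclusionInDoubleDual_surjective
      ((testPairs Ω).topologicalClosure.convex.inter (convex_closedBall 0 C))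
      ((testPairs Ω).isClosed_topologicalClosure.inter Metric.isClosed_closedBall)
      (Metric.isBounded_closedBall.subset inter_subset_right) _
  refine (memH10_iff_mem_image hu).2 (image_mono inter_subset_left
    (hclosed.closure_subset (Metric.mem_closure_iff.2 fun ε hε => ?_)))
  obtain ⟨w, hw, hwC, hwu⟩ := h (ε / 2) (half_pos hε)
  refine ⟨_, ⟨h1Pair (hw.memLp _) (hw.memLp_gradient _),
    ⟨subset_closure hw.h1Pair_mem_testPairs, ?_⟩, rfl⟩, ?_⟩
  · rwa [mem_closedBall_zero_iff, norm_h1Pair]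
  · have hdist : ‖(hw.memLp _).toLp w - hu.toLp u‖ ≤ ε / 2 := by
      rw [← MemLp.toLp_sub, ← pow_le_pow_iff_left₀ (norm_nonneg _) (half_pos hε).le two_ne_zero,
        norm_toLp_sq]
      simpa only [Pi.sub_apply, Real.norm_eq_abs, sq_abs] using hwu
    rw [dist_comm, dist_eq_norm]
    exact hdist.trans_lt (half_lt_self hε)

end H1Pair

section Truncation

variable {ε t : ℝ}

/-- The derivative of `smoothTruncation ε`: a smooth cutoff with values in `[0, 1]`, equal to `0`
on `[-ε, ε]` and to `1` outside `(-2ε, 2ε)`. -/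
noncomputable def truncationSlope (ε t : ℝ) : ℝ :=
  Real.smoothTransition (t ^ 2 / ε ^ 2 - 1)

/-- A smooth version of the truncation `t ↦ sign t * max (|t| - ε) 0`. -/
noncomputable def smoothTruncation (ε t : ℝ) : ℝ :=
  ∫ x in (0 : ℝ)..t, truncationSlope ε x

lemma truncationSlope_nonneg (ε t : ℝ) : 0 ≤ truncationSlope ε t :=
  Real.smoothTransition.nonneg _

lemma truncationSlope_le_one (ε t : ℝ) : truncationSlope ε t ≤ 1 :=
  Real.smoothTransition.le_one _

lemma truncationSlope_eq_zero (ht : |t| ≤ ε) : truncationSlope ε t = 0 := by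
  refine Real.smoothTransition.zero_of_nonpos (sub_nonpos.2 (div_le_one_of_le₀ ?_ (sq_nonneg ε)))
  exact sq_le_sq.2 (ht.trans (le_abs_self ε))

lemma truncationSlope_eq_one (hε : 0 < ε) (ht : 2 * ε ≤ |t|) : truncationSlope ε t = 1 := by
  refine Real.smoothTransition.one_of_one_le ?_
  rw [le_sub_iff_add_le, le_div_iff₀ (by positivity), ← sq_abs t]
  nlinarith

lemma contDiff_truncationSlope (ε : ℝ) : ContDiff ℝ ∞ (truncationSlope ε) :=
  Real.smoothTransition.contDiff.comp (((contDiff_id.pow 2).div_const _).sub contDiff_const)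

lemma hasDerivAt_smoothTruncation (ε t : ℝ) :
    HasDerivAt (smoothTruncation ε) (truncationSlope ε t) t :=
  ((contDiff_truncationSlope ε).continuous.integral_hasStrictDerivAt 0 t).hasDerivAt

lemma contDiff_smoothTruncation (ε : ℝ) : ContDiff ℝ ∞ (smoothTruncation ε) := by
  rw [contDiff_infty_iff_deriv, funext fun t => (hasDerivAt_smoothTruncation ε t).deriv]
  exact ⟨fun t => (hasDerivAt_smoothTruncation ε t).differentiableAt, contDiff_truncationSlope ε⟩

lemma smoothTruncation_zero (ε : ℝ) : smoothTruncation ε 0 = 0 :=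
  intervalIntegral.integral_same

lemma smoothTruncation_eq_zero (ht : |t| ≤ ε) : smoothTruncation ε t = 0 := by
  have h0 : (0 : ℝ) ∈ Icc (-ε) ε := abs_le.1 (abs_zero.trans_le ((abs_nonneg t).trans ht))
  have h := (convex_Icc (-ε) ε).norm_image_sub_le_of_norm_hasDerivWithin_le (C := 0)
    (fun x _ => (hasDerivAt_smoothTruncation ε x).hasDerivWithinAt)
    (fun x hx => by rw [truncationSlope_eq_zero (abs_le.2 hx), norm_zero]) h0 (abs_le.1 ht)
  simpa [smoothTruncation_zero] using h

lemma hasDerivAt_smoothTruncation_sub_id (ε t : ℝ) :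
    HasDerivAt (fun t => smoothTruncation ε t - t) (truncationSlope ε t - 1) t :=
  (hasDerivAt_smoothTruncation ε t).sub (hasDerivAt_id t)

lemma abs_smoothTruncation_sub_le_abs (ε t : ℝ) : |smoothTruncation ε t - t| ≤ |t| := by
  have norm_slope_le (x : ℝ) : ‖truncationSlope ε x - 1‖ ≤ 1 := by
    rw [Real.norm_eq_abs, abs_le]
    constructor <;> linarith [truncationSlope_nonneg ε x, truncationSlope_le_one ε x]
  have h := convex_univ.norm_image_sub_le_of_norm_hasDerivWithin_le (C := 1)
    (fun x _ => (hasDerivAt_smoothTruncation_sub_id ε x).hasDerivWithinAt)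
    (fun x _ => norm_slope_le x) (mem_univ 0) (mem_univ t)
  simpa [smoothTruncation_zero] using h

lemma smoothTruncation_sub_eq_of_convex {S : Set ℝ} (hε : 0 < ε) (hS : Convex ℝ S)
    (hS' : ∀ x ∈ S, 2 * ε ≤ |x|) {a : ℝ} (ha : a ∈ S) (ht : t ∈ S) :
    smoothTruncation ε t - t = smoothTruncation ε a - a := by
  have h := hS.norm_image_sub_le_of_norm_hasDerivWithin_le (C := 0)
    (fun x _ => (hasDerivAt_smoothTruncation_sub_id ε x).hasDerivWithinAt)
    (fun x hx => by rw [truncationSlope_eq_one hε (hS' x hx), sub_self, norm_zero]) ha ht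
  rwa [zero_mul, norm_le_zero_iff, sub_eq_zero] at h

lemma abs_smoothTruncation_sub_le (hε : 0 < ε) (t : ℝ) : |smoothTruncation ε t - t| ≤ 2 * ε := by
  have h2ε : |2 * ε| = 2 * ε := abs_of_pos (by positivity)
  rcases le_total |t| (2 * ε) with h | h
  · exact (abs_smoothTruncation_sub_le_abs ε t).trans h
  · rcases le_abs'.1 h with h | h
    · rw [smoothTruncation_sub_eq_of_convex hε (convex_Iic (-(2 * ε)))
        (fun x hx => le_abs'.2 (.inl hx)) self_mem_Iic h]
      exact (abs_smoothTruncation_sub_le_abs ε _).trans_eq ((abs_neg _).trans h2ε)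
    · rw [smoothTruncation_sub_eq_of_convex hε (convex_Ici (2 * ε))
        (fun x hx => le_abs'.2 (.inr hx)) self_mem_Ici h]
      exact (abs_smoothTruncation_sub_le_abs ε _).trans_eq h2ε

end Truncation

section Energy

variable {d : ℕ} {Ω : Set (Eu d)} {u w : Eu d → ℝ}

lemma h1Norm_sq (Ω : Set (Eu d)) (u : Eu d → ℝ) (g : Eu d → Eu d) :
    h1Norm Ω u g ^ 2 = (∫ x in Ω, u x ^ 2) + ∫ x in Ω, ‖g x‖ ^ 2 :=
  Real.sq_sqrt (add_nonneg (integral_nonneg fun _ => sq_nonneg _)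
    (integral_nonneg fun _ => sq_nonneg _))

lemma HasH1Gradient.integral_norm_gradient_comp_sq_le {f s : ℝ → ℝ}
    (hu : HasH1Gradient Ω u (∇ u)) (hu' : Differentiable ℝ u)
    (hf : ∀ t, HasDerivAt f (s t) t) (hs0 : ∀ t, 0 ≤ s t) (hs1 : ∀ t, s t ≤ 1)
    (hw : IsTestFunction Ω fun x => f (u x)) :
    ∫ x in Ω, ‖∇ (fun y => f (u y)) x‖ ^ 2 ≤ -∫ x in Ω, u x * (Δ fun y => f (u y)) x := by
  rw [hu.integral_mul_laplacian hw, neg_neg]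
  refine integral_mono (hw.memLp_gradient _).norm.integrable_sq
    (integrable_inner_of_memLp hu.memLp_gradient (hw.memLp_gradient _)) fun x => ?_
  simp only [gradient_comp_of_hasDerivAt (hf (u x)) (hu' x), norm_smul, inner_smul_right,
    real_inner_self_eq_norm_sq, mul_pow, Real.norm_eq_abs, sq_abs]
  gcongr
  exact pow_le_of_le_one (hs0 _) (hs1 _) two_ne_zero

lemma integral_norm_gradient_sq_le_of_le_mul_h1Norm {g : Eu d → Eu d} {M : ℝ}
    (h : ∫ x in Ω, ‖g x‖ ^ 2 ≤ M * h1Norm Ω w g) :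
    ∫ x in Ω, ‖g x‖ ^ 2 ≤ M ^ 2 + ∫ x in Ω, w x ^ 2 := by
  nlinarith [h1Norm_sq Ω w g, sq_nonneg (M - h1Norm Ω w g)]

end Energy

section Mollification

variable {d : ℕ} {Ω : Set (Eu d)} {v w ρ : Eu d → ℝ} {M : ℝ}

/-- The norm of `Δv` in `H⁻¹(Ω)` is at most `M`. -/
def HasLaplacianBound (Ω : Set (Eu d)) (v : Eu d → ℝ) (M : ℝ) : Prop :=
  ∀ w : Eu d → ℝ, IsTestFunction Ω w →
    |∫ x in Ω, v x * (Δ w) x| ≤ M * h1Norm Ω w (∇ w)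

lemma integral_convolution_mul_laplacian (hρ : Continuous ρ) (hρc : HasCompactSupport ρ)
    (hv : Continuous v) (hw : IsTestFunction Ω w) :
    ∫ x, (∫ y, ρ y * v (x - y)) * (Δ w) x = ∫ y, ρ y * ∫ x, v x * (Δ w) (x + y) := by
  have integral_swap : ∫ x, ∫ y, ρ y * v (x - y) * (Δ w) x =
      ∫ y, ∫ x, ρ y * v (x - y) * (Δ w) x := by
    refine integral_integral_swap_of_hasCompactSupport
      (((hρ.comp continuous_snd).mul (hv.comp (continuous_fst.sub continuous_snd))).mul
        ((continuous_laplacian hw.contDiff_two).comp continuous_fst))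
      (HasCompactSupport.intro ((hasCompactSupport_laplacian hw.compact).prod hρc) fun p hp => ?_)
    rcases not_and_or.1 hp with hp | hp
    all_goals simp [Function.uncurry, image_eq_zero_of_notMem_tsupport hp]
  simp_rw [← integral_mul_const]
  rw [integral_swap]
  refine integral_congr_ae (.of_forall fun y => ?_)
  dsimp only
  rw [← integral_const_mul, ← integral_add_right_eq_self _ y]
  simp only [add_sub_cancel_right, mul_assoc]

lemma HasLaplacianBound.abs_integral_convolution_le (hM : HasLaplacianBound Ω v M)
    (hv : Continuous v) (hv0 : ∀ x ∉ Ω, v x = 0) (hρ : Continuous ρ)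
    (hρc : HasCompactSupport ρ) (hρ0 : ∀ y, 0 ≤ ρ y) (hρ1 : ∫ y, ρ y = 1)
    (hw : IsTestFunction Ω w)
    (hwy : ∀ y, ρ y ≠ 0 → IsTestFunction Ω fun x => w (x + y)) :
    |∫ x in Ω, (∫ y, ρ y * v (x - y)) * (Δ w) x| ≤ M * h1Norm Ω w (∇ w) := by
  have bound (y : Eu d) : ‖ρ y * ∫ x, v x * (Δ w) (x + y)‖ ≤ ρ y * (M * h1Norm Ω w (∇ w)) := by
    rw [norm_mul, Real.norm_of_nonneg (hρ0 y)]
    by_cases hy : ρ y = 0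
    · rw [hy, zero_mul, zero_mul]
    · have h := hM _ (hwy y hy)
      rw [hw.h1Norm_comp_add_right (hwy y hy),
        setIntegral_eq_integral_of_forall_compl_eq_zero fun x hx => by
          rw [hv0 x hx, zero_mul]] at h
      simp only [laplacian_comp_add_right] at h
      exact mul_le_mul_of_nonneg_left h (hρ0 y)
  rw [setIntegral_eq_integral_of_forall_compl_eq_zero fun x hx => by
      rw [hw.laplacian_eq_zero_of_notMem hx, mul_zero],
    integral_convolution_mul_laplacian hρ hρc hv hw, ← Real.norm_eq_abs]
  calc ‖∫ y, ρ y * ∫ x, v x * (Δ w) (x + y)‖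
      ≤ ∫ y, ρ y * (M * h1Norm Ω w (∇ w)) :=
        norm_integral_le_of_norm_le ((hρ.integrable_of_hasCompactSupport hρc).mul_const _)
          (.of_forall bound)
    _ = M * h1Norm Ω w (∇ w) := by rw [integral_mul_const, hρ1, one_mul]

end Mollification

section Approximation

lemma exists_contDiffBump_dist_convolution_le {E F : Type*} [NormedAddCommGroup E]
    [NormedSpace ℝ E] [FiniteDimensional ℝ E] [MeasurableSpace E] [BorelSpace E]
    [NormedAddCommGroup F] [NormedSpace ℝ F] [CompleteSpace F] (μ : Measure E)
    [μ.IsAddHaarMeasure] {v : E → F} (hv : UniformContinuous v) {δ ε : ℝ} (hδ : 0 < δ)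
    (hε : 0 < ε) :
    ∃ φ : ContDiffBump (0 : E), φ.rOut ≤ δ ∧
      ∀ x, dist (convolution (φ.normed μ) v (ContinuousLinearMap.lsmul ℝ ℝ) μ x) (v x) ≤ ε := by
  obtain ⟨δ', hδ', hvδ'⟩ := Metric.uniformContinuous_iff.1 hv ε hε
  have hmin : 0 < min δ δ' := lt_min hδ hδ'
  refine ⟨⟨min δ δ' / 2, min δ δ', half_pos hmin, half_lt_self hmin⟩, min_le_left _ _,
    fun x => ContDiffBump.dist_normed_convolution_le hv.continuous.aestronglyMeasurable
      fun y hy => (hvδ' ?_).le⟩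
  exact (Metric.mem_ball.1 hy).trans_le (min_le_right _ _)

variable {d : ℕ} {Ω : Set (Eu d)} {u v : Eu d → ℝ} {M ε : ℝ}

lemma tsupport_smoothTruncation_comp_subset (hv : Continuous v)
    (huv : ∀ x, |u x - v x| ≤ ε / 2) :
    tsupport (fun x => smoothTruncation ε (u x)) ⊆ {x | ε / 2 ≤ |v x|} := by
  refine closure_minimal (fun x hx => ?_) (isClosed_le continuous_const hv.abs)
  have hlt : ε < |u x| := by
    by_contra! hle
    exact hx (smoothTruncation_eq_zero hle)
  rw [mem_ofPred_eq]
  linarith [abs_sub_abs_le_abs_sub (u x) (v x), huv x]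

lemma abs_smoothTruncation_comp_sub_le (hε : 0 < ε) {x : Eu d} (huv : |u x - v x| ≤ ε / 2) :
    |smoothTruncation ε (u x) - v x| ≤ 3 * ε := by
  linarith [abs_sub_le (smoothTruncation ε (u x)) (u x) (v x),
    abs_smoothTruncation_sub_le hε (u x)]

lemma HasLaplacianBound.exists_testFunction_approx (hM : HasLaplacianBound Ω v M)
    (hΩ : IsOpen Ω) (hv : Continuous v) (hvc : HasCompactSupport v) (hv0 : ∀ x ∉ Ω, v x = 0)
    (hε : 0 < ε) :
    ∃ w : Eu d → ℝ, IsTestFunction Ω w ∧ (∀ x, |w x - v x| ≤ 3 * ε) ∧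
      ∫ x in Ω, ‖∇ w x‖ ^ 2 ≤ M ^ 2 + ∫ x in Ω, w x ^ 2 := by
  let K : Set (Eu d) := {x | ε / 2 ≤ |v x|}
  have hv_ne {x : Eu d} (hx : x ∈ K) : v x ≠ 0 := abs_pos.1 ((half_pos hε).trans_le hx)
  have hKΩ : K ⊆ Ω := fun x hx => by_contra fun h => hv_ne hx (hv0 x h)
  have hK : IsCompact K := hvc.of_isClosed_subset (isClosed_le continuous_const hv.abs)
    fun x hx => subset_closure (hv_ne hx)
  obtain ⟨δ, hδ, hKδ⟩ := hK.exists_thickening_subset_open hΩ hKΩ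
  obtain ⟨φ, hφδ, huv⟩ := exists_contDiffBump_dist_convolution_le volume
    (hvc.uniformContinuous_of_continuous hv) hδ (half_pos hε)
  let u : Eu d → ℝ :=
    convolution (φ.normed volume) v (ContinuousLinearMap.lsmul ℝ ℝ) volume
  have hu : ContDiff ℝ ∞ u := φ.hasCompactSupport_normed.contDiff_convolution_left _
    φ.contDiff_normed hv.locallyIntegrable
  have huc : HasCompactSupport u := φ.hasCompactSupport_normed.convolution _ hvc
  have hsupp : tsupport (fun x => smoothTruncation ε (u x)) ⊆ K :=
    tsupport_smoothTruncation_comp_subset hv huv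
  have hw : IsTestFunction Ω fun x => smoothTruncation ε (u x) :=
    ⟨(contDiff_smoothTruncation ε).comp hu, hK.of_isClosed_subset (isClosed_tsupport _) hsupp,
      hsupp.trans hKΩ⟩
  have hwy (y : Eu d) (hy : φ.normed volume y ≠ 0) :
      IsTestFunction Ω fun x => smoothTruncation ε (u (x + y)) := by
    rw [← Function.mem_support, φ.support_normed_eq, mem_ball_zero_iff] at hy
    refine hw.comp_add_right y fun x hx => hKδ (Metric.mem_thickening_iff.2 ⟨x + y, hsupp hx, ?_⟩)
    exact (dist_self_add_right y x).trans_lt (hy.trans_le hφδ)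
  refine ⟨_, hw, fun x => abs_smoothTruncation_comp_sub_le hε (huv x),
    integral_norm_gradient_sq_le_of_le_mul_h1Norm ?_⟩
  calc ∫ x in Ω, ‖∇ (fun x => smoothTruncation ε (u x)) x‖ ^ 2
      ≤ -∫ x in Ω, u x * (Δ fun x => smoothTruncation ε (u x)) x :=
        (hasH1Gradient_gradient (contDiff_infty.1 hu 1) huc Ω).integral_norm_gradient_comp_sq_le
          (hu.differentiable (by simp)) (hasDerivAt_smoothTruncation ε)
          (truncationSlope_nonneg ε) (truncationSlope_le_one ε) hw
    _ ≤ |∫ x in Ω, u x * (Δ fun x => smoothTruncation ε (u x)) x| := neg_le_abs _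
    _ ≤ _ := hM.abs_integral_convolution_le hv hv0 φ.continuous_normed
        φ.hasCompactSupport_normed φ.nonneg_normed φ.integral_normed hw hwy

end Approximation

section VanishingAtBoundary

variable {d : ℕ} {Ω : Set (Eu d)} {u v : Eu d → ℝ} {C M : ℝ}

lemma memH10_of_uniform_approx (hΩ : volume Ω < ⊤) (hu : MemLp u 2 (volume.restrict Ω))
    {B : ℝ} (hB : ∀ x ∈ Ω, |u x| ≤ B)
    (h : ∀ ε : ℝ, 0 < ε → ∃ w : Eu d → ℝ, IsTestFunction Ω w ∧ (∀ x ∈ Ω, |w x - u x| ≤ ε) ∧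
      ∫ x in Ω, ‖∇ w x‖ ^ 2 ≤ C + ∫ x in Ω, w x ^ 2) : MemH10 Ω u := by
  refine memH10_of_bounded_approx (C := √(C + 2 * ((B + 1) ^ 2 * volume.real Ω))) hu
    fun ε hε => ?_
  have hvol : 0 < volume.real Ω + 1 := add_pos_of_nonneg_of_pos measureReal_nonneg one_pos
  obtain ⟨w, hw, hwu, hgrad⟩ := h (min 1 (ε / (volume.real Ω + 1)))
    (lt_min one_pos (div_pos hε hvol))
  refine ⟨w, hw, Real.sqrt_le_sqrt ?_, ?_⟩
  · have hsq : ∫ x in Ω, w x ^ 2 ≤ (B + 1) ^ 2 * volume.real Ω :=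
      setIntegral_sq_le_of_abs_le hΩ fun x hx => by
        linarith [(hwu x hx).trans (min_le_left _ _), hB x hx, abs_sub_abs_le_abs_sub (w x) (u x)]
    linarith
  · calc ∫ x in Ω, (w x - u x) ^ 2
        ≤ (ε / (volume.real Ω + 1)) ^ 2 * volume.real Ω :=
          setIntegral_sq_le_of_abs_le hΩ fun x hx => (hwu x hx).trans (min_le_right _ _)
      _ ≤ (ε / (volume.real Ω + 1)) ^ 2 * (volume.real Ω + 1) ^ 2 := by
          gcongr
          nlinarith [measureReal_nonneg (μ := volume) (s := Ω)]
      _ = ε ^ 2 := by rw [← mul_pow, div_mul_cancel₀ _ hvol.ne']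

lemma HasLaplacianBound.indicator (hM : HasLaplacianBound Ω v M) (hΩ : MeasurableSet Ω) :
    HasLaplacianBound Ω (Ω.indicator v) M := fun w hw => by
  rw [setIntegral_congr_fun (g := fun x => v x * (Δ w) x) hΩ fun x hx => by
    simp only [indicator_of_mem hx]]
  exact hM w hw

namespace IsC0

lemma continuous_indicator (hv : IsC0 Ω v) (hΩ : IsOpen Ω) : Continuous (Ω.indicator v) := by
  refine continuous_iff_continuousAt.2 fun x => ?_
  by_cases hx : x ∈ Ω
  · exact (hv.continuousOn.continuousAt (hΩ.mem_nhds hx)).congr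
      ((eqOn_indicator.symm : EqOn v (Ω.indicator v) Ω).eventuallyEq_of_mem (hΩ.mem_nhds hx))
  · rw [ContinuousAt, indicator_of_notMem hx, ← nhdsWithin_univ, ← union_compl_self Ω,
      nhdsWithin_union, tendsto_sup]
    constructor
    · refine Tendsto.congr' (eqOn_indicator.symm.eventuallyEq_nhdsWithin) ?_
      by_cases hx' : x ∈ closure Ω
      · exact hv.tendsto_zero x ⟨hx', by rwa [hΩ.interior_eq]⟩
      · rw [notMem_closure_iff_nhdsWithin_eq_bot.1 hx']
        exact tendsto_bot
    · exact tendsto_const_nhds.congr' (eqOn_indicator'.symm.eventuallyEq_nhdsWithin)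

lemma hasCompactSupport_indicator (hΩ : Bornology.IsBounded Ω) (v : Eu d → ℝ) :
    HasCompactSupport (Ω.indicator v) :=
  HasCompactSupport.intro hΩ.isCompact_closure fun _ hx =>
    indicator_of_notMem (fun h => hx (subset_closure h)) v

theorem memH10 (hv : IsC0 Ω v) (hΩ : IsOpen Ω) (hΩb : Bornology.IsBounded Ω)
    (hΔ : LaplacianMemHNegOne Ω v) : MemH10 Ω v := by
  obtain ⟨M, -, hM⟩ := hΔ
  have hV := hv.continuous_indicator hΩ
  have hVc := hasCompactSupport_indicator hΩb v
  obtain ⟨B, hB⟩ := hVc.exists_bound_of_continuous hV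
  have hv2 : MemLp v 2 (volume.restrict Ω) :=
    (memLp_indicator_iff_restrict hΩ.measurableSet).1 (hV.memLp_of_hasCompactSupport hVc)
  refine memH10_of_uniform_approx (C := M ^ 2) hΩb.measure_lt_top hv2
    (fun x hx => by simpa [indicator_of_mem hx] using hB x) fun ε hε => ?_
  obtain ⟨w, hw, hwV, hgrad⟩ := (HasLaplacianBound.indicator hM hΩ.measurableSet)
    |>.exists_testFunction_approx hΩ hV hVc (fun x hx => indicator_of_notMem hx v)
      (div_pos hε three_pos)
  refine ⟨w, hw, fun x hx => ?_, hgrad⟩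
  simpa only [indicator_of_mem hx, mul_div_cancel₀ ε three_ne_zero] using hwV x

end IsC0

end VanishingAtBoundary

section Extension

variable {d : ℕ} {Ω : Set (Eu d)} {φ : frontier Ω → ℝ} {Φ Φ₁ Φ₂ u₁ u₂ w : Eu d → ℝ}

namespace IsAdmissibleExtension

lemma integrableOn_mul_laplacian (h : IsAdmissibleExtension Ω φ Φ)
    (hΩb : Bornology.IsBounded Ω) (hw : IsTestFunction Ω w) :
    IntegrableOn (fun x => Φ x * (Δ w) x) Ω :=
  ((h.continuousOn.mul (continuous_laplacian hw.contDiff_two).continuousOn).integrableOn_compact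
    hΩb.isCompact_closure).mono_set subset_closure

lemma integral_sub_mul_laplacian (h₁ : IsAdmissibleExtension Ω φ Φ₁)
    (h₂ : IsAdmissibleExtension Ω φ Φ₂) (hΩb : Bornology.IsBounded Ω)
    (hw : IsTestFunction Ω w) :
    ∫ x in Ω, (Φ₁ - Φ₂) x * (Δ w) x =
      (∫ x in Ω, Φ₁ x * (Δ w) x) - ∫ x in Ω, Φ₂ x * (Δ w) x := by
  simp only [Pi.sub_apply, sub_mul]
  exact integral_sub (h₁.integrableOn_mul_laplacian hΩb hw)
    (h₂.integrableOn_mul_laplacian hΩb hw)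

lemma isC0_sub (h₁ : IsAdmissibleExtension Ω φ Φ₁) (h₂ : IsAdmissibleExtension Ω φ Φ₂) :
    IsC0 Ω (Φ₁ - Φ₂) := by
  have hc : ContinuousOn (Φ₁ - Φ₂) (closure Ω) := h₁.continuousOn.sub h₂.continuousOn
  refine ⟨hc.mono subset_closure, fun z hz => ?_⟩
  have h0 : (Φ₁ - Φ₂) z = 0 := by
    rw [Pi.sub_apply, h₁.extends_boundary ⟨z, hz⟩, h₂.extends_boundary ⟨z, hz⟩, sub_self]
  exact h0 ▸ (hc z (frontier_subset_closure hz)).mono subset_closure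

lemma laplacianMemHNegOne_sub (h₁ : IsAdmissibleExtension Ω φ Φ₁)
    (h₂ : IsAdmissibleExtension Ω φ Φ₂) (hΩb : Bornology.IsBounded Ω) :
    LaplacianMemHNegOne Ω (Φ₁ - Φ₂) := by
  obtain ⟨M₁, hM₁0, hM₁⟩ := h₁.laplacian_mem
  obtain ⟨M₂, hM₂0, hM₂⟩ := h₂.laplacian_mem
  refine ⟨M₁ + M₂, add_nonneg hM₁0 hM₂0, fun w hw => ?_⟩
  rw [h₁.integral_sub_mul_laplacian h₂ hΩb hw, add_mul]
  exact (abs_sub _ _).trans (add_le_add (hM₁ w hw) (hM₂ w hw))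

end IsAdmissibleExtension

lemma HasH10Gradient.ae_eq_zero_of_weaklyHarmonic {v : Eu d → ℝ} {g : Eu d → Eu d}
    (h : HasH10Gradient Ω v g) (hd : 0 < d) (hΩb : Bornology.IsBounded Ω)
    (hharm : ∀ w : Eu d → ℝ, IsTestFunction Ω w → ∫ x in Ω, ⟪g x, ∇ w x⟫_ℝ = 0) :
    v =ᵐ[volume.restrict Ω] 0 := by
  obtain ⟨R, hR⟩ := hΩb.exists_norm_le
  have he : ‖(EuclideanSpace.single ⟨0, hd⟩ 1 : Eu d)‖ = 1 := by simp
  refine h.ae_eq_zero (R := R) he (fun x hx => ?_) (h.gradient_ae_eq_zero hharm)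
  exact ((abs_real_inner_le_norm _ x).trans_eq (by rw [he, one_mul])).trans (hR x hx)

theorem IsVariationalSolutionFrom.eqOn (hu₁ : IsVariationalSolutionFrom Ω Φ₁ u₁)
    (hu₂ : IsVariationalSolutionFrom Ω Φ₂ u₂) (h₁ : IsAdmissibleExtension Ω φ Φ₁)
    (h₂ : IsAdmissibleExtension Ω φ Φ₂) (hd : 0 < d) (hΩ : IsOpen Ω)
    (hΩb : Bornology.IsBounded Ω) : EqOn u₁ u₂ Ω := by
  obtain ⟨harm₁, v₁, g₁, hv₁, hvar₁, hae₁⟩ := hu₁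
  obtain ⟨harm₂, v₂, g₂, hv₂, hvar₂, hae₂⟩ := hu₂
  obtain ⟨g, hg⟩ := (h₁.isC0_sub h₂).memH10 hΩ hΩb (h₁.laplacianMemHNegOne_sub h₂ hΩb)
  have weaklyHarmonic (w : Eu d → ℝ) (hw : IsTestFunction Ω w) :
      ∫ x in Ω, ⟪(g - (g₁ - g₂)) x, ∇ w x⟫_ℝ = 0 := by
    have integrable_inner {v : Eu d → ℝ} {g : Eu d → Eu d} (hv : HasH10Gradient Ω v g) :
        Integrable (fun x => ⟪g x, ∇ w x⟫_ℝ) (volume.restrict Ω) :=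
      integrable_inner_of_memLp hv.hasH1Gradient.memLp_gradient (hw.memLp_gradient _)
    have integral_eq := hg.hasH1Gradient.integral_mul_laplacian hw
    rw [h₁.integral_sub_mul_laplacian h₂ hΩb hw, hvar₁ w hw, hvar₂ w hw] at integral_eq
    simp only [Pi.sub_apply, inner_sub_left]
    rw [integral_sub (integrable_inner hg) ((integrable_inner hv₁).sub' (integrable_inner hv₂)),
      integral_sub (integrable_inner hv₁) (integrable_inner hv₂)]
    linarith
  have hzero := (hg.sub (hv₁.sub hv₂)).ae_eq_zero_of_weaklyHarmonic hd hΩb weaklyHarmonic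
  refine Measure.eqOn_open_of_ae_eq (μ := volume) ?_ hΩ harm₁.contDiffOn.continuousOn
    harm₂.contDiffOn.continuousOn
  filter_upwards [hzero, hae₁, hae₂] with x h0 e₁ e₂
  simp only [Pi.sub_apply, Pi.zero_apply] at h0
  linarith

end Extension

theorem lemma2p2_general {d : ℕ} (hd : 0 < d) (Ω : Set (Eu d)) (hΩ_open : IsOpen Ω)
    (hΩ_bdd : Bornology.IsBounded Ω) :
    (∀ v : Eu d → ℝ, IsC0 Ω v → LaplacianMemHNegOne Ω v → MemH10 Ω v) ∧
    (∀ (φ : frontier Ω → ℝ) (Φ₁ Φ₂ u₁ u₂ : Eu d → ℝ),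
      IsAdmissibleExtension Ω φ Φ₁ → IsAdmissibleExtension Ω φ Φ₂ →
      IsVariationalSolutionFrom Ω Φ₁ u₁ → IsVariationalSolutionFrom Ω Φ₂ u₂ →
      EqOn u₁ u₂ Ω) :=
  ⟨fun _ hv hΔ => hv.memH10 hΩ_open hΩ_bdd hΔ,
    fun _ _ _ _ _ h₁ h₂ hu₁ hu₂ => hu₁.eqOn hu₂ h₁ h₂ hd hΩ_open hΩ_bdd⟩

theorem lemma2p2 {d : ℕ} (hd : 2 ≤ d) (Ω : Set (Eu d)) (hΩ_open : IsOpen Ω)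
    (hΩ_conn : IsConnected Ω) (hΩ_bdd : Bornology.IsBounded Ω) :
    (∀ v : Eu d → ℝ, IsC0 Ω v → LaplacianMemHNegOne Ω v → MemH10 Ω v) ∧
    (∀ φ : frontier Ω → ℝ, Continuous φ →
      ∀ Φ₁ Φ₂ u₁ u₂ : Eu d → ℝ,
        IsAdmissibleExtension Ω φ Φ₁ → IsAdmissibleExtension Ω φ Φ₂ →
        IsVariationalSolutionFrom Ω Φ₁ u₁ → IsVariationalSolutionFrom Ω Φ₂ u₂ →
        EqOn u₁ u₂ Ω) :=
  have h := lemma2p2_general (zero_lt_two.trans_le hd) Ω hΩ_open hΩ_bdd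
  ⟨h.1, fun φ _ => h.2 φ⟩
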